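/- **Setting.** $N\ge 1$ agents are the vertices of an undirected graph $G$; agent $i$ has a continuously differentiable $f_i:\mathbb R^K\to\mathbb R$. Put $f=\frac1N\sum_i f_i$, and write $\bar{\mathbf x}=\frac1N\sum_i \mathbf x_i$ for $\mathbf x=(\mathbf x_1,\dots,\mathbf x_N)$; $\|\cdot\|$ is the $\ell_2$ norm. *Problem.* For each compact $X\subset\mathbb R^K$ and each $i$ there is a finite constant $L_i(X)\ge 1$, monotone in $X$, with $\|\nabla f_i(\mathbf y)-\nabla f_i(\mathbf z)\|\le L_i(X)\|\mathbf y-\mathbf z\|$ for $\mathbf y,\mathbf z\in X$; and $f(\mathbf u)>\underline f$ for all $\mathbf u$. *Weights.* $\mathbf W\in\mathbb R^{N\times N}$ is symmetric, $\mathrm{Null}(\mathbf I-\mathbf W)=\mathrm{span}\{\mathbf 1\}$, $-\mathbf I\preceq\mathbf W\preceq\mathbf I$, $W_{ij}>0$ if $i,j$ are neighbors, $W_{ij}=0$ if $i\ne j$ are not neighbors, $W_{ii}\ge 0$, and $\eta:=\|\mathbf W-\frac1N\mathbf 1\mathbf 1^T\|<1$ (spectral norm; this is the second largest absolute value of an eigenvalue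 of $\mathbf W$). *MAGENTA.* Let $\mathbf x(0)$ be the initial point, $\mathbf y_i(0)=\nabla f_i(\mathbf x_i(0))$, $\mathbf z=\bar{\mathbf x}(0)$, let $0\le v^0\le v^1\le v^2\le\cdots$ be radii, $X(t)=\{\mathbf u:\|\mathbf u-\mathbf z\|\le v^t\}$, with $\mathbf x_i(0)\in X(1)$ for all $i$. Let $\hat L(t)=\max_i L_i(X(t))$, $\gamma,\xi>0$ with $(1+\gamma)\eta^2<1$ and $(1+\xi)\eta^2<1$, $\beta=\frac12$, and $$\alpha(t)=\min\left\{\frac1{8N}\cdot\frac1{\hat L(t)/(2N)+1/\gamma+5/4},\ \frac{N(1-(1+\gamma)\eta^2)(1-(1+\xi)\eta^2)}{64(1+1/\xi)\hat L^2(t)},\ 1\right\}.$$ Stage $t=1,2,\dots$ starts at the final point of stage $t-1$ (stage 1 at $(\mathbf x(0),\mathbf y(0))$) and makes $R(t)=\lceil 1/(\epsilon\alpha(t))\rceil$ inner iterations $$\widetilde{\mathbf x}_i^{r+1}=\arg\min_{\mathbf u\in X(t)}\langle \mathbf y_i^r,\mathbf u-\mathbf x_i^r\rangle+\tfrac1{2\alpha(t)}\|\mathbf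 u-\mathbf x_i^r\|^2,\quad \mathbf x_i^{r+1}=\sum_j W_{ij}\bigl(\mathbf x_j^r+\beta(\widetilde{\mathbf x}_j^{r+1}-\mathbf x_j^r)\bigr),\quad \mathbf y_i^{r+1}=\sum_j W_{ij}\mathbf y_j^r+\nabla f_i(\mathbf x_i^{r+1})-\nabla f_i(\mathbf x_i^r).$$ Each inner iteration is one round of local gradient computation and of message exchange among neighbors. With the iterates of stage $t$ put $$\text{avg-gap}(t)=\frac1{R(t)}\sum_{r=0}^{R(t)-1}\left(\|\mathbf y^r\|^2+\|\mathbf x^r-\mathbf 1\bar{\mathbf x}^r\|^2+\|\mathbf y^r-\mathbf 1\bar{\mathbf y}^r\|^2\right),$$ and let $$P_0=f(\bar{\mathbf x}(0))+\|\mathbf x(0)-\mathbf 1\bar{\mathbf x}(0)\|^2+\frac{1-(1+\gamma)\eta^2}{32(1+1/\xi)\hat L^2(1)}\|\mathbf y(0)-\mathbf 1\bar{\mathbf y}(0)\|^2 .$$ **Theorem.** Let $0<\epsilon<2(1-(1+\gamma)\eta^2)$ and let the integer $T^*>0$ satisfy $$T^*=\left\lceil\frac1\epsilon\cdot\frac{128(P_0-\underline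 f)}{\frac1{T^*}\sum_{t=1}^{T^*}(v^t-v^{t-1})^2}\right\rceil .$$ Then there is a stage $t\in\{1,\dots,T^*\}$ that is $\mathcal O(\epsilon)$-stationary for the unconstrained problem: $\text{avg-gap}(t)\le C\,(P_0-\underline f)\,\epsilon$ with $$C=\max\left\{32N,\ \frac4{1-(1+\gamma)\eta^2},\ \frac{32N(1+1/\xi)}{1-(1+\xi)\eta^2}\right\}.$$ The number of rounds of local gradient computation and message exchange made in the stages $1,\dots,T^*$ is $\sum_{t=1}^{T^*}\lceil 1/(\epsilon\alpha(t))\rceil$. It lies in $[S,S+T^*)$, and equals $S$ if all $1/(\epsilon\alpha(t))$, $1\le t\le T^*$, are integers, where $$S=\frac1\epsilon\sum_{t=1}^{T^*}\frac1{\alpha(t)}=\frac1\epsilon\sum_{t=1}^{T^*}\max\left\{4\hat L(t)+\frac{8N}\gamma+10N,\ \frac{64(1+1/\xi)\hat L^2(t)}{N(1-(1+\gamma)\eta^2)(1-(1+\xi)\eta^2)},\ 1\right\}.$$ -/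

import Mathlib

noncomputable section

namespace Magenta

/-- The space `ℝ^K` with its Euclidean norm. -/
abbrev Vec (K : ℕ) := EuclideanSpace ℝ (Fin K)

/-- The average `(1/N) ∑ i, x i` of the agents' vectors. -/
def average {N K : ℕ} (x : Fin N → Vec K) : Vec K :=
  (1 / (N : ℝ)) • ∑ i, x i

/-- Squared `ℓ²` norm of the stacked vector `(x 1; …; x N)` of `ℝ^{NK}`. -/
def stackedSq {N K : ℕ} (x : Fin N → Vec K) : ℝ :=
  ∑ i, ‖x i‖ ^ 2

/-- Squared consensus error `‖x - 1 x̄‖²`. -/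
def consensusSq {N K : ℕ} (x : Fin N → Vec K) : ℝ :=
  stackedSq fun i => x i - average x

/-- The average objective `f(u) = (1/N) ∑ i, f_i(u)`. -/
def avgFun {N K : ℕ} (f : Fin N → Vec K → ℝ) (u : Vec K) : ℝ :=
  (1 / (N : ℝ)) * ∑ i, f i u

/-- Assumptions on the problem. `Lip i X` is the constant `L_i(X)` attached to the compact
set `X`. -/
structure ProblemAssumption {N K : ℕ} (f : Fin N → Vec K → ℝ)
    (Lip : Fin N → Set (Vec K) → ℝ) (fLow : ℝ) : Prop where
  contDiff : ∀ i, ContDiff ℝ 1 (f i)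
  lipschitz : ∀ i, ∀ X : Set (Vec K), IsCompact X → ∀ y ∈ X, ∀ z ∈ X,
    ‖gradient (f i) y - gradient (f i) z‖ ≤ Lip i X * ‖y - z‖
  one_le : ∀ i, ∀ X : Set (Vec K), IsCompact X → 1 ≤ Lip i X
  mono : ∀ i, ∀ X₁ X₂ : Set (Vec K), IsCompact X₁ → IsCompact X₂ → X₁ ⊆ X₂ →
    Lip i X₁ ≤ Lip i X₂
  lower : ∀ u, fLow < avgFun f u

/-- The operator norm `η` of `W - (1/N) 1 1ᵀ`. For a mixing matrix this is the second largest
absolute value of an eigenvalue of `W`. -/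
def mixingRate {N : ℕ} (W : Matrix (Fin N) (Fin N) ℝ) : ℝ :=
  ‖Matrix.toEuclideanCLM (n := Fin N) (𝕜 := ℝ) (W - Matrix.of fun _ _ => 1 / (N : ℝ))‖

/-- Assumptions on the weight matrix `W` of the communication graph `G`. -/
structure WeightAssumption {N : ℕ} (G : SimpleGraph (Fin N))
    (W : Matrix (Fin N) (Fin N) ℝ) : Prop where
  symm : W.IsSymm
  ker : LinearMap.ker (Matrix.mulVecLin (1 - W)) = Submodule.span ℝ {(1 : Fin N → ℝ)}
  neg_one_le : (1 + W).PosSemidef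
  le_one : (1 - W).PosSemidef
  eq_zero : ∀ i j, i ≠ j → ¬ G.Adj i j → W i j = 0
  pos : ∀ i j, G.Adj i j → 0 < W i j
  diag_nonneg : ∀ i, 0 ≤ W i i
  mixingRate_lt_one : mixingRate W < 1

/-- The data on which MAGENTA runs: local functions, Lipschitz constants on compact sets,
weight matrix, initial point, radii of the stages, the parameters `γ`, `ξ`, and the accuracy. -/
structure Input (N K : ℕ) where
  f : Fin N → Vec K → ℝ
  Lip : Fin N → Set (Vec K) → ℝ
  W : Matrix (Fin N) (Fin N) ℝ
  x₀ : Fin N → Vec K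
  v : ℕ → ℝ
  γ : ℝ
  ξ : ℝ
  ε : ℝ

/-- State of all agents, with the number of rounds made so far. In one round every agent exchanges
messages with its neighbours once and computes one new local gradient. -/
structure State (N K : ℕ) where
  x : Fin N → Vec K
  y : Fin N → Vec K
  rounds : ℕ

open Classical in
/-- The minimizer over `p ∈ X` of `⟪y, p - x⟫ + ‖p - x‖² / (2α)`. -/
def proxStep {K : ℕ} (X : Set (Vec K)) (α : ℝ) (y x : Vec K) : Vec K :=
  if h : ∃ p ∈ X, IsMinOn (fun q => inner ℝ y (q - x) + 1 / (2 * α) * ‖q - x‖ ^ 2) X p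
  then h.choose else x

/-- One inner iteration with feasible set `X` and stepsizes `α`, `β`. Since `W i j = 0` when `j`
is neither `i` nor a neighbour of `i`, the sums over all `j` only use messages of neighbours. -/
def innerStep {N K : ℕ} (f : Fin N → Vec K → ℝ) (W : Matrix (Fin N) (Fin N) ℝ)
    (X : Set (Vec K)) (α β : ℝ) (s : State N K) : State N K :=
  let xt : Fin N → Vec K := fun i => proxStep X α (s.y i) (s.x i)
  let v : Fin N → Vec K := fun i => xt i - s.x i
  let x' : Fin N → Vec K := fun i => ∑ j, W i j • (s.x j + β • v j)
  { x := x'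
    y := fun i => (∑ j, W i j • s.y j) + gradient (f i) (x' i) - gradient (f i) (s.x i)
    rounds := s.rounds + 1 }

namespace Input

variable {N K : ℕ} (M : Input N K)

/-- The contraction factor of the weight matrix. -/
def η : ℝ := mixingRate M.W

/-- The feasible set `X(t)`: closed ball of radius `v^t` around the average initial point. -/
def X (t : ℕ) : Set (Vec K) := Metric.closedBall (average M.x₀) (M.v t)

/-- `L̂(t) = max_i L_i(X(t))`. -/
def Lhat (t : ℕ) : ℝ := ⨆ i, M.Lip i (M.X t)

/-- The stepsize `α(t)`. -/
def α (t : ℕ) : ℝ :=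
  min (min (1 / (8 * (N : ℝ)) * (1 / (M.Lhat t / (2 * N) + (1 / M.γ + 5 / 4))))
    (N * (1 - (1 + M.γ) * M.η ^ 2) * (1 - (1 + M.ξ) * M.η ^ 2)
      / (64 * (1 + 1 / M.ξ) * M.Lhat t ^ 2))) 1

/-- Number of inner iterations of stage `t`: `1/(ε α(t))`, rounded up to an integer. -/
def R (t : ℕ) : ℕ := ⌈1 / (M.ε * M.α t)⌉₊

/-- The initial gradients `y_i = ∇f_i(x_i)`. -/
def y₀ (i : Fin N) : Vec K := gradient (M.f i) (M.x₀ i)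

/-- One inner iteration of stage `t`, with `β = 1/2`. -/
def stageStep (t : ℕ) : State N K → State N K :=
  innerStep M.f M.W (M.X t) (M.α t) (1 / 2)

/-- The state after the stages `1, …, T`. -/
def afterStages : ℕ → State N K
  | 0 => { x := M.x₀, y := M.y₀, rounds := 0 }
  | t + 1 => (M.stageStep (t + 1))^[M.R (t + 1)] (afterStages t)

/-- The `r`-th inner iterate `(x^r, y^r)` of stage `t ≥ 1`. -/
def iter (t r : ℕ) : State N K := (M.stageStep t)^[r] (M.afterStages (t - 1))

/-- The stationarity gap of stage `t` for the unconstrained problem. -/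
def avgGap (t : ℕ) : ℝ :=
  1 / (M.R t : ℝ) * ∑ r ∈ Finset.range (M.R t),
    (stackedSq (M.iter t r).y + consensusSq (M.iter t r).x + consensusSq (M.iter t r).y)

/-- The potential function `P(w; t)` at `w = (x, y, x̄, ȳ)`. -/
def potential (x y : Fin N → Vec K) (t : ℕ) : ℝ :=
  avgFun M.f (average x) + consensusSq x
    + (1 - (1 + M.γ) * M.η ^ 2) / (32 * (1 + 1 / M.ξ) * M.Lhat t ^ 2) * consensusSq y

/-- The value `P(w⁰; 1)` of the potential at the start of the first stage. -/
def initialPotential : ℝ := M.potential M.x₀ M.y₀ 1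

/-- The equation for the number of stages. -/
def IsStageNumber (fLow : ℝ) (T : ℕ) : Prop :=
  0 < T ∧
    T = ⌈1 / M.ε * (128 * (M.initialPotential - fLow)
      / (1 / (T : ℝ) * ∑ t ∈ Finset.Icc 1 T, (M.v t - M.v (t - 1)) ^ 2))⌉₊

/-- The constant in front of `(P(w⁰; 1) - fLow) ε` in the stationarity bound. -/
def gapConst : ℝ :=
  max (max (32 * (N : ℝ)) (4 / (1 - (1 + M.γ) * M.η ^ 2)))
    (32 * N * (1 + 1 / M.ξ) / (1 - (1 + M.ξ) * M.η ^ 2))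

end Input

end Magenta

end

/-!
Every inner iteration decreases the potential
`f(x̄) + ‖x - 1 x̄‖² + c(t) ‖y - 1 ȳ‖²` by at least a multiple of
`‖x̃ - x‖² / α(t) + ‖x - 1 x̄‖² + c(t) ‖y - 1 ȳ‖²`, because mixing contracts both errors and the
average of the `y_i` tracks the average of the local gradients. The potential stays above `fLow`, so
the decreases of all stages together are less than `P₀ - fLow`.

If all proximal points of a stage are interior to `X(t)`, they are gradient steps
`x̃_i - x_i = -α(t) y_i`, and the decrease in that stage bounds its stationarity gap. Otherwise some
proximal point on the boundary of `X(t)` is at distance at least `v^t - v^{t-1}` from the initial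
average of the stage. By the Cauchy-Schwarz inequality over fewer than `1 / (ε α(t))` iterations,
covering this distance costs a decrease of order `ε (v^t - v^{t-1})²`. The equation for the number
of stages prevents this from happening in every stage.
-/

namespace Magenta

theorem add_add_sq_le_mul {p q r : ℝ} (hp : 0 < p) (hq : 0 < q) (hr : 0 < r) (a b c : ℝ) :
    (a + b + c) ^ 2 ≤ (p + q + r) * (a ^ 2 / p + b ^ 2 / q + c ^ 2 / r) := by
  have h := Finset.sq_sum_div_le_sum_sq_div Finset.univ ![a, b, c] (g := ![p, q, r])
    (by simp [Fin.forall_fin_succ, hp, hq, hr])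
  simpa [Fin.sum_univ_three, div_le_iff₀' (add_pos (add_pos hp hq) hr)] using h

theorem one_div_min_eq_max {a b : ℝ} (ha : 0 < a) (hb : 0 < b) :
    1 / min a b = max (1 / a) (1 / b) := by
  rcases le_total a b with h | h
  · rw [min_eq_left h, max_eq_left (one_div_le_one_div_of_le ha h)]
  · rw [min_eq_right h, max_eq_right (one_div_le_one_div_of_le hb h)]

section InnerProductSpace

variable {E : Type*} [NormedAddCommGroup E] [InnerProductSpace ℝ E]

theorem real_inner_le_add_mul_norm_sq {a : ℝ} (ha : 0 < a) (u v : E) :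
    inner ℝ u v ≤ a / 2 * ‖u‖ ^ 2 + 1 / (2 * a) * ‖v‖ ^ 2 := by
  have h : 2 * ‖u‖ * ‖v‖ ≤ a * ‖u‖ ^ 2 + a⁻¹ * ‖v‖ ^ 2 := two_mul_le_add_mul_sq ha
  calc inner ℝ u v ≤ ‖u‖ * ‖v‖ := real_inner_le_norm u v
    _ ≤ (a * ‖u‖ ^ 2 + a⁻¹ * ‖v‖ ^ 2) / 2 := by linarith
    _ = a / 2 * ‖u‖ ^ 2 + 1 / (2 * a) * ‖v‖ ^ 2 := by ring

theorem norm_add_sq_le_add_mul_norm_sq {a : ℝ} (ha : 0 < a) (u v : E) :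
    ‖u + v‖ ^ 2 ≤ (1 + a) * ‖u‖ ^ 2 + (1 + 1 / a) * ‖v‖ ^ 2 := by
  have h := real_inner_le_add_mul_norm_sq ha u v
  calc ‖u + v‖ ^ 2 = ‖u‖ ^ 2 + 2 * inner ℝ u v + ‖v‖ ^ 2 := norm_add_sq_real u v
    _ ≤ ‖u‖ ^ 2 + 2 * (a / 2 * ‖u‖ ^ 2 + 1 / (2 * a) * ‖v‖ ^ 2) + ‖v‖ ^ 2 := by gcongr
    _ = (1 + a) * ‖u‖ ^ 2 + (1 + 1 / a) * ‖v‖ ^ 2 := by ring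

/-- The gradient of `f` is Lipschitz on `X`. Unlike in `LipschitzOnWith` the constant `L` is a real
number, because the constants `L_i(X)` are. -/
def LipschitzGradientOn [CompleteSpace E] (f : E → ℝ) (L : ℝ) (X : Set E) : Prop :=
  ∀ y ∈ X, ∀ z ∈ X, ‖gradient f y - gradient f z‖ ≤ L * ‖y - z‖

theorem LipschitzGradientOn.le_add_inner_gradient [CompleteSpace E] {f : E → ℝ} {L : ℝ}
    {X : Set E} (hL : LipschitzGradientOn f L X) (hf : ∀ x ∈ X, DifferentiableAt ℝ f x)
    (hX : Convex ℝ X) {a b : E} (ha : a ∈ X) (hb : b ∈ X) :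
    f b ≤ f a + inner ℝ (gradient f a) (b - a) + L / 2 * ‖b - a‖ ^ 2 := by
  set d := b - a with hd
  have hmem : ∀ s ∈ Set.Icc (0 : ℝ) 1, a + s • d ∈ X := fun s hs =>
    hX.add_smul_sub_mem ha hb hs
  have hderiv : ∀ s ∈ Set.Icc (0 : ℝ) 1,
      HasDerivAt (fun s : ℝ => f (a + s • d)) (inner ℝ (gradient f (a + s • d)) d) s := by
    intro s hs
    have hline : HasDerivAt (fun s : ℝ => a + s • d) d s := by
      simpa using ((hasDerivAt_id s).smul_const d).const_add a
    exact (hf _ (hmem s hs)).hasGradientAt.hasFDerivAt.comp_hasDerivAt s hline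
  have hmodel : ∀ s : ℝ, HasDerivAt
      (fun s => f a + s * inner ℝ (gradient f a) d + L / 2 * ‖d‖ ^ 2 * s ^ 2)
      (inner ℝ (gradient f a) d + L * ‖d‖ ^ 2 * s) s := fun s =>
    ((((hasDerivAt_id s).mul_const _).const_add (f a)).add
      ((hasDerivAt_pow 2 s).const_mul (L / 2 * ‖d‖ ^ 2))).congr_deriv (by push_cast; ring)
  have hslope : ∀ s ∈ Set.Ico (0 : ℝ) 1, inner ℝ (gradient f (a + s • d)) d
      ≤ inner ℝ (gradient f a) d + L * ‖d‖ ^ 2 * s := by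
    intro s hs
    have hnorm : ‖gradient f (a + s • d) - gradient f a‖ ≤ L * (s * ‖d‖) := by
      simpa [norm_smul, abs_of_nonneg hs.1] using hL _ (hmem s ⟨hs.1, hs.2.le⟩) a ha
    calc inner ℝ (gradient f (a + s • d)) d
        = inner ℝ (gradient f a) d + inner ℝ (gradient f (a + s • d) - gradient f a) d := by
          rw [inner_sub_left]
          ring
      _ ≤ inner ℝ (gradient f a) d + L * (s * ‖d‖) * ‖d‖ := by
          gcongr
          exact (real_inner_le_norm _ _).trans (by gcongr)
      _ = inner ℝ (gradient f a) d + L * ‖d‖ ^ 2 * s := by ring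
  have h := image_le_of_deriv_right_le_deriv_boundary
    (fun s hs => (hderiv s hs).continuousAt.continuousWithinAt)
    (fun s hs => (hderiv s ⟨hs.1, hs.2.le⟩).hasDerivWithinAt) (by simp)
    (fun s _ => (hmodel s).continuousAt.continuousWithinAt)
    (fun s _ => (hmodel s).hasDerivWithinAt) hslope (Set.right_mem_Icc.2 zero_le_one)
  simpa [hd] using h

theorem sub_eq_neg_smul_of_isLocalMin_prox {α : ℝ} (hα : α ≠ 0) {x y p : E}
    (hp : IsLocalMin (fun q => inner ℝ y (q - x) + 1 / (2 * α) * ‖q - x‖ ^ 2) p) :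
    p - x = -(α • y) := by
  have hsub : HasFDerivAt (fun q : E => q - x) (ContinuousLinearMap.id ℝ E) p :=
    (hasFDerivAt_id p).sub_const x
  have hderiv := ((innerSL ℝ y).hasFDerivAt.comp p hsub).add
    (hsub.norm_sq.const_mul (1 / (2 * α)))
  have hzero := hp.hasFDerivAt_eq_zero hderiv
  have hinner : inner ℝ (y + (1 / α) • (p - x)) (y + (1 / α) • (p - x)) = 0 := by
    have h := DFunLike.congr_fun hzero (y + (1 / α) • (p - x))
    simp only [add_apply, smul_apply,
      ContinuousLinearMap.comp_apply, ContinuousLinearMap.id_apply, innerSL_apply_apply,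
      zero_apply, smul_eq_mul, nsmul_eq_mul, Nat.cast_ofNat] at h
    rw [inner_add_left, real_inner_smul_left, ← h]
    ring
  have h : α • (y + (1 / α) • (p - x)) = 0 := by
    rw [inner_self_eq_zero.1 hinner, smul_zero]
  rw [smul_add, smul_smul, mul_one_div_cancel hα, one_smul] at h
  exact eq_neg_of_add_eq_zero_right h

end InnerProductSpace

section Stacked

variable {N K : ℕ}

theorem stackedSq_eq_norm_sq (x : Fin N → Vec K) : stackedSq x = ‖WithLp.toLp 2 x‖ ^ 2 :=
  (PiLp.norm_sq_eq_of_L2 _ (WithLp.toLp 2 x)).symm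

theorem stackedSq_nonneg (x : Fin N → Vec K) : 0 ≤ stackedSq x :=
  Finset.sum_nonneg fun _ _ => sq_nonneg _

theorem norm_sq_le_stackedSq (x : Fin N → Vec K) (i : Fin N) : ‖x i‖ ^ 2 ≤ stackedSq x :=
  Finset.single_le_sum (f := fun i => ‖x i‖ ^ 2) (fun _ _ => sq_nonneg _) (Finset.mem_univ i)

theorem stackedSq_smul (a : ℝ) (x : Fin N → Vec K) : stackedSq (a • x) = a ^ 2 * stackedSq x := by
  simp [stackedSq, norm_smul, mul_pow, Finset.mul_sum]

theorem stackedSq_sub_comm (x y : Fin N → Vec K) : stackedSq (x - y) = stackedSq (y - x) := by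
  simp [stackedSq, norm_sub_rev]

theorem stackedSq_add_le {a : ℝ} (ha : 0 < a) (x y : Fin N → Vec K) :
    stackedSq (x + y) ≤ (1 + a) * stackedSq x + (1 + 1 / a) * stackedSq y := by
  simp only [stackedSq_eq_norm_sq, WithLp.toLp_add]
  exact norm_add_sq_le_add_mul_norm_sq ha _ _

theorem average_add (x y : Fin N → Vec K) : average (x + y) = average x + average y := by
  simp [average, Finset.sum_add_distrib]

theorem average_sub (x y : Fin N → Vec K) : average (x - y) = average x - average y := by
  simp [average, Finset.sum_sub_distrib, smul_sub]

theorem average_smul (a : ℝ) (x : Fin N → Vec K) : average (a • x) = a • average x := by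
  simp [average, ← Finset.smul_sum, smul_comm a]

theorem consensusSq_nonneg (x : Fin N → Vec K) : 0 ≤ consensusSq x := stackedSq_nonneg _

theorem consensusSq_smul (a : ℝ) (x : Fin N → Vec K) :
    consensusSq (a • x) = a ^ 2 * consensusSq x := by
  rw [consensusSq, consensusSq, ← stackedSq_smul, average_smul]
  congr 1
  ext i
  simp [mul_sub]

theorem consensusSq_add_le {a : ℝ} (ha : 0 < a) (x y : Fin N → Vec K) :
    consensusSq (x + y) ≤ (1 + a) * consensusSq x + (1 + 1 / a) * consensusSq y := by
  refine Eq.trans_le ?_ (stackedSq_add_le ha _ _)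
  rw [consensusSq, average_add]
  congr 1
  ext i
  simp [add_sub_add_comm]

variable [NeZero N]

theorem natCast_smul_average (x : Fin N → Vec K) : (N : ℝ) • average x = ∑ i, x i := by
  rw [average, smul_smul, mul_one_div_cancel (NeZero.ne _), one_smul]

theorem average_const (z : Vec K) : average (Function.const (Fin N) z) = z := by
  simp [average, ← Nat.cast_smul_eq_nsmul ℝ, smul_smul]

theorem average_mem {X : Set (Vec K)} (hX : Convex ℝ X) {x : Fin N → Vec K}
    (hx : ∀ i, x i ∈ X) : average x ∈ X := by
  rw [average, Finset.smul_sum]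
  exact hX.sum_mem (fun _ _ => by positivity) (by simp) fun i _ => hx i

theorem natCast_mul_inner_average (g : Vec K) (x : Fin N → Vec K) :
    N * inner ℝ g (average x) = ∑ i, inner ℝ g (x i) := by
  rw [← real_inner_smul_right, natCast_smul_average, inner_sum]

theorem consensusSq_add_natCast_mul_norm_average_sq (x : Fin N → Vec K) :
    consensusSq x + N * ‖average x‖ ^ 2 = stackedSq x := by
  have h := natCast_mul_inner_average (average x) x
  rw [real_inner_self_eq_norm_sq] at h
  simp only [consensusSq, stackedSq, norm_sub_sq_real, Finset.sum_add_distrib,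
    Finset.sum_sub_distrib, ← Finset.mul_sum, real_inner_comm (average x), ← h,
    Finset.sum_const, Finset.card_univ, Fintype.card_fin, nsmul_eq_mul]
  ring

theorem consensusSq_le_stackedSq (x : Fin N → Vec K) : consensusSq x ≤ stackedSq x := by
  rw [← consensusSq_add_natCast_mul_norm_average_sq x]
  exact le_add_of_nonneg_right (by positivity)

theorem natCast_mul_norm_average_sq_le (x : Fin N → Vec K) :
    N * ‖average x‖ ^ 2 ≤ stackedSq x := by
  rw [← consensusSq_add_natCast_mul_norm_average_sq x]
  exact le_add_of_nonneg_left (consensusSq_nonneg x)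

end Stacked

section Mix

variable {N K : ℕ} {W : Matrix (Fin N) (Fin N) ℝ}

/-- One exchange of messages with weights `W`, that is, multiplication of the stacked vector by
`W ⊗ I`. -/
def mix (W : Matrix (Fin N) (Fin N) ℝ) : (Fin N → Vec K) →ₗ[ℝ] (Fin N → Vec K) :=
  LinearMap.pi fun i => ∑ j, W i j • LinearMap.proj j

theorem mix_apply (W : Matrix (Fin N) (Fin N) ℝ) (x : Fin N → Vec K) (i : Fin N) :
    mix W x i = ∑ j, W i j • x j := by
  simp [mix]

theorem stackedSq_mix_le_opNorm (A : Matrix (Fin N) (Fin N) ℝ) (x : Fin N → Vec K) :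
    stackedSq (mix A x)
      ≤ ‖Matrix.toEuclideanCLM (n := Fin N) (𝕜 := ℝ) A‖ ^ 2 * stackedSq x := by
  simp only [stackedSq, EuclideanSpace.real_norm_sq_eq]
  rw [Finset.sum_comm, Finset.sum_comm (f := fun i k => (x i).ofLp k ^ 2), Finset.mul_sum]
  refine Finset.sum_le_sum fun k _ => ?_
  have h := pow_le_pow_left₀ (norm_nonneg _)
    ((Matrix.toEuclideanCLM (n := Fin N) (𝕜 := ℝ) A).le_opNorm
      (WithLp.toLp 2 fun j => (x j).ofLp k)) 2
  rw [mul_pow, EuclideanSpace.real_norm_sq_eq, EuclideanSpace.real_norm_sq_eq] at h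
  simpa [mix_apply, Matrix.mulVec, dotProduct] using h

theorem mix_mem (hW : W ∈ Matrix.rowStochastic ℝ (Fin N)) {X : Set (Vec K)} (hX : Convex ℝ X)
    {x : Fin N → Vec K} (hx : ∀ i, x i ∈ X) (i : Fin N) : mix W x i ∈ X := by
  rw [mix_apply]
  exact hX.sum_mem (fun _ _ => Matrix.nonneg_of_mem_rowStochastic hW)
    (Matrix.sum_row_of_mem_rowStochastic hW i) fun j _ => hx j

theorem mix_const (hW : W ∈ Matrix.rowStochastic ℝ (Fin N)) (z : Vec K) :
    mix W (Function.const (Fin N) z) = Function.const (Fin N) z := by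
  ext1 i
  simp only [mix_apply, Function.const_apply]
  rw [← Finset.sum_smul, Matrix.sum_row_of_mem_rowStochastic hW, one_smul]

theorem average_mix (hW : W ∈ Matrix.colStochastic ℝ (Fin N)) (x : Fin N → Vec K) :
    average (mix W x) = average x := by
  simp only [average, mix_apply]
  rw [Finset.sum_comm]
  simp [← Finset.sum_smul, Matrix.sum_col_of_mem_colStochastic hW]

theorem stackedSq_mix_le (hW : W ∈ doublyStochastic ℝ (Fin N)) (x : Fin N → Vec K) :
    stackedSq (mix W x) ≤ stackedSq x := by
  have hconv : ConvexOn ℝ Set.univ fun z : Vec K => ‖z‖ ^ 2 :=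
    convexOn_univ_norm.pow (fun _ _ => norm_nonneg _) 2
  calc stackedSq (mix W x)
      ≤ ∑ i, ∑ j, W i j * ‖x j‖ ^ 2 :=
        Finset.sum_le_sum fun i _ => by
          simpa [mix_apply] using hconv.map_sum_le (t := Finset.univ) (w := W i) (p := x)
            (fun _ _ => nonneg_of_mem_doublyStochastic hW) (sum_row_of_mem_doublyStochastic hW i)
            fun _ _ => Set.mem_univ _
    _ = stackedSq x := by
        rw [Finset.sum_comm]
        simp [← Finset.sum_mul, sum_col_of_mem_doublyStochastic hW, stackedSq]

theorem mix_averaging (x : Fin N → Vec K) :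
    mix (Matrix.of fun _ _ => 1 / (N : ℝ)) x = Function.const (Fin N) (average x) := by
  ext1 i
  simp [mix_apply, average, Finset.smul_sum]

theorem mix_matrix_sub (A B : Matrix (Fin N) (Fin N) ℝ) (x : Fin N → Vec K) :
    mix (A - B) x = mix A x - mix B x := by
  ext1 i
  simp [mix_apply, sub_smul]

theorem mix_sub_averaging [NeZero N] (hW : W ∈ doublyStochastic ℝ (Fin N)) (x : Fin N → Vec K) :
    mix (W - Matrix.of fun _ _ => 1 / (N : ℝ)) (x - Function.const (Fin N) (average x))
      = mix W x - Function.const (Fin N) (average (mix W x)) := by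
  obtain ⟨hrow, hcol⟩ := mem_doublyStochastic_iff_mem_rowStochastic_and_mem_colStochastic.1 hW
  rw [mix_matrix_sub, mix_averaging, average_sub, average_const, sub_self, map_sub,
    mix_const hrow, average_mix hcol]
  simp

theorem consensusSq_mix_le [NeZero N] (hW : W ∈ doublyStochastic ℝ (Fin N)) (x : Fin N → Vec K) :
    consensusSq (mix W x) ≤ mixingRate W ^ 2 * consensusSq x :=
  (congrArg stackedSq (mix_sub_averaging hW x)).ge.trans (stackedSq_mix_le_opNorm _ _)

theorem stackedSq_mix_add_sub_le (hW : W ∈ doublyStochastic ℝ (Fin N)) (x w : Fin N → Vec K) :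
    stackedSq (mix W (x + w) - x) ≤ 8 * consensusSq x + 2 * stackedSq w := by
  set e := x - Function.const (Fin N) (average x) with he
  have hrow := (mem_doublyStochastic_iff_mem_rowStochastic_and_mem_colStochastic.1 hW).1
  have hsplit : mix W (x + w) - x = (mix W e + (-1 : ℝ) • e) + mix W w := by
    rw [he, map_add, map_sub, mix_const hrow]
    module
  have hdiff : stackedSq (mix W e + (-1 : ℝ) • e) ≤ 4 * consensusSq x := by
    calc stackedSq (mix W e + (-1 : ℝ) • e)
        ≤ (1 + 1) * stackedSq (mix W e) + (1 + 1 / 1) * stackedSq ((-1 : ℝ) • e) :=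
          stackedSq_add_le one_pos _ _
      _ ≤ (1 + 1) * stackedSq e + (1 + 1 / 1) * ((-1) ^ 2 * stackedSq e) := by
          rw [stackedSq_smul]
          gcongr
          exact stackedSq_mix_le hW e
      _ = 4 * stackedSq e := by ring
  calc stackedSq (mix W (x + w) - x)
      ≤ (1 + 1) * stackedSq (mix W e + (-1 : ℝ) • e) + (1 + 1 / 1) * stackedSq (mix W w) := by
        rw [hsplit]
        exact stackedSq_add_le one_pos _ _
    _ ≤ (1 + 1) * (4 * consensusSq x) + (1 + 1 / 1) * stackedSq w := by
        gcongr
        exact stackedSq_mix_le hW w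
    _ = 8 * consensusSq x + 2 * stackedSq w := by ring

theorem WeightAssumption.mem_doublyStochastic {G : SimpleGraph (Fin N)}
    (hW : WeightAssumption G W) : W ∈ doublyStochastic ℝ (Fin N) := by
  have hrow : W.mulVec 1 = 1 := by
    have h : (1 : Fin N → ℝ) ∈ LinearMap.ker (Matrix.mulVecLin (1 - W)) := by
      rw [hW.ker]
      exact Submodule.mem_span_singleton_self _
    rw [LinearMap.mem_ker, Matrix.mulVecLin_apply, Matrix.sub_mulVec, Matrix.one_mulVec] at h
    exact (sub_eq_zero.1 h).symm
  refine _root_.mem_doublyStochastic.2 ⟨fun i j => ?_, hrow, ?_⟩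
  · by_cases hij : i = j
    · exact hij ▸ hW.diag_nonneg i
    · by_cases hG : G.Adj i j
      · exact (hW.pos i j hG).le
      · exact (hW.eq_zero i j hij hG).ge
  · rw [← Matrix.mulVec_transpose, hW.symm.eq, hrow]

end Mix

section Prox

variable {K : ℕ} {X : Set (Vec K)}

theorem proxStep_mem_and_isMinOn (hX : IsCompact X) (hne : X.Nonempty) (α : ℝ) (y x : Vec K) :
    proxStep X α y x ∈ X ∧
      IsMinOn (fun q => inner ℝ y (q - x) + 1 / (2 * α) * ‖q - x‖ ^ 2) X
        (proxStep X α y x) := by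
  have h : ∃ p ∈ X, IsMinOn (fun q => inner ℝ y (q - x) + 1 / (2 * α) * ‖q - x‖ ^ 2) X p :=
    hX.exists_isMinOn hne (by fun_prop)
  rw [proxStep, dif_pos h]
  exact h.choose_spec

theorem proxStep_mem (hX : IsCompact X) (hne : X.Nonempty) (α : ℝ) (y x : Vec K) :
    proxStep X α y x ∈ X :=
  (proxStep_mem_and_isMinOn hX hne α y x).1

theorem isMinOn_proxStep (hX : IsCompact X) (hne : X.Nonempty) (α : ℝ) (y x : Vec K) :
    IsMinOn (fun q => inner ℝ y (q - x) + 1 / (2 * α) * ‖q - x‖ ^ 2) X (proxStep X α y x) :=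
  (proxStep_mem_and_isMinOn hX hne α y x).2

theorem inner_proxStep_sub_le (hX : IsCompact X) {x : Vec K} (hx : x ∈ X) (α : ℝ) (y : Vec K) :
    inner ℝ y (proxStep X α y x - x) ≤ -(1 / (2 * α)) * ‖proxStep X α y x - x‖ ^ 2 := by
  have h := isMinOn_iff.1 (isMinOn_proxStep hX ⟨x, hx⟩ α y x) x hx
  simp only [sub_self, inner_zero_right, norm_zero] at h
  linarith

theorem proxStep_sub_eq_neg_smul (hX : IsCompact X) {α : ℝ} (hα : α ≠ 0) {y x : Vec K}
    (hmem : proxStep X α y x ∈ interior X) : proxStep X α y x - x = -(α • y) :=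
  sub_eq_neg_smul_of_isLocalMin_prox hα <|
    (isMinOn_proxStep hX ⟨_, interior_subset hmem⟩ α y x).isLocalMin
      (mem_interior_iff_mem_nhds.1 hmem)

end Prox

section InnerStep

variable {N K : ℕ} {f : Fin N → Vec K → ℝ} {W : Matrix (Fin N) (Fin N) ℝ} {X : Set (Vec K)}
  {α β L : ℝ} {s : State N K}

/-- The displacements `x̃_i - x_i` of one inner iteration from the state `s`. -/
noncomputable def direction (X : Set (Vec K)) (α : ℝ) (s : State N K) : Fin N → Vec K :=
  fun i => proxStep X α (s.y i) (s.x i) - s.x i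

/-- The stacked local gradients `(∇f_1(x_1); …; ∇f_N(x_N))`. -/
noncomputable def stackedGradient (f : Fin N → Vec K → ℝ) (x : Fin N → Vec K) : Fin N → Vec K :=
  fun i => gradient (f i) (x i)

/-- The invariant of gradient tracking: the average of the `y_i` is the average of the local
gradients. -/
def State.Tracks (f : Fin N → Vec K → ℝ) (s : State N K) : Prop :=
  average s.y = average (stackedGradient f s.x)

theorem innerStep_x (f : Fin N → Vec K → ℝ) (W : Matrix (Fin N) (Fin N) ℝ) (X : Set (Vec K))
    (α β : ℝ) (s : State N K) :
    (innerStep f W X α β s).x = mix W (s.x + β • direction X α s) := by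
  ext1 i
  rw [mix_apply]
  rfl

theorem innerStep_y (f : Fin N → Vec K → ℝ) (W : Matrix (Fin N) (Fin N) ℝ) (X : Set (Vec K))
    (α β : ℝ) (s : State N K) :
    (innerStep f W X α β s).y = mix W s.y
      + (stackedGradient f (innerStep f W X α β s).x - stackedGradient f s.x) := by
  ext1 i
  rw [Pi.add_apply, mix_apply]
  exact add_sub_assoc _ _ _

theorem innerStep_x_mem (hW : W ∈ Matrix.rowStochastic ℝ (Fin N)) (hXc : Convex ℝ X)
    (hXk : IsCompact X) (hβ : β ∈ Set.Icc 0 1) (hs : ∀ i, s.x i ∈ X) (i : Fin N) :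
    (innerStep f W X α β s).x i ∈ X := by
  rw [innerStep_x]
  exact mix_mem hW hXc
    (fun j => hXc.add_smul_sub_mem (hs j) (proxStep_mem hXk ⟨_, hs j⟩ α (s.y j) _) hβ) i

theorem average_innerStep_x (hW : W ∈ Matrix.colStochastic ℝ (Fin N)) :
    average (innerStep f W X α β s).x = average s.x + β • average (direction X α s) := by
  rw [innerStep_x, average_mix hW, average_add, average_smul]

theorem State.Tracks.innerStep (hW : W ∈ Matrix.colStochastic ℝ (Fin N)) (hs : s.Tracks f) :
    (innerStep f W X α β s).Tracks f := by
  rw [State.Tracks, innerStep_y, average_add, average_mix hW, hs, average_sub, add_sub_cancel]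

theorem stackedSq_stackedGradient_sub_le (hL : ∀ i, LipschitzGradientOn (f i) L X)
    {x z : Fin N → Vec K} (hx : ∀ i, x i ∈ X) (hz : ∀ i, z i ∈ X) :
    stackedSq (stackedGradient f x - stackedGradient f z) ≤ L ^ 2 * stackedSq (x - z) := by
  simp only [stackedSq, Finset.mul_sum, ← mul_pow]
  exact Finset.sum_le_sum fun i _ =>
    pow_le_pow_left₀ (norm_nonneg _) (hL i _ (hx i) _ (hz i)) 2

variable [NeZero N]

theorem consensusSq_innerStep_x_le (hW : W ∈ doublyStochastic ℝ (Fin N)) {a : ℝ} (ha : 0 < a) :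
    consensusSq (innerStep f W X α β s).x ≤ mixingRate W ^ 2 *
      ((1 + a) * consensusSq s.x + (1 + 1 / a) * (β ^ 2 * stackedSq (direction X α s))) := by
  rw [innerStep_x]
  refine (consensusSq_mix_le hW _).trans ?_
  gcongr
  refine (consensusSq_add_le ha _ _).trans ?_
  rw [consensusSq_smul]
  gcongr
  exact consensusSq_le_stackedSq _

theorem consensusSq_innerStep_y_le (hW : W ∈ doublyStochastic ℝ (Fin N)) (hXc : Convex ℝ X)
    (hXk : IsCompact X) (hL : ∀ i, LipschitzGradientOn (f i) L X) (hβ : β ∈ Set.Icc 0 1)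
    (hs : ∀ i, s.x i ∈ X) {a : ℝ} (ha : 0 < a) :
    consensusSq (innerStep f W X α β s).y ≤
      (1 + a) * (mixingRate W ^ 2 * consensusSq s.y) + (1 + 1 / a) *
        (L ^ 2 * (8 * consensusSq s.x + 2 * (β ^ 2 * stackedSq (direction X α s)))) := by
  have hrow := (mem_doublyStochastic_iff_mem_rowStochastic_and_mem_colStochastic.1 hW).1
  rw [innerStep_y]
  refine (consensusSq_add_le ha _ _).trans ?_
  gcongr
  · exact consensusSq_mix_le hW s.y
  · refine (consensusSq_le_stackedSq _).trans
      ((stackedSq_stackedGradient_sub_le hL (innerStep_x_mem hrow hXc hXk hβ hs) hs).trans ?_)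
    gcongr
    rw [innerStep_x, ← stackedSq_smul]
    exact stackedSq_mix_add_sub_le hW _ _

theorem avgFun_le (hL : ∀ i, LipschitzGradientOn (f i) L X)
    (hf : ∀ i, ∀ x ∈ X, DifferentiableAt ℝ (f i) x) (hX : Convex ℝ X) {a b : Vec K}
    (ha : a ∈ X) (hb : b ∈ X) :
    avgFun f b ≤ avgFun f a
      + inner ℝ (average (stackedGradient f (Function.const (Fin N) a))) (b - a)
      + L / 2 * ‖b - a‖ ^ 2 := by
  calc avgFun f b
      ≤ 1 / N * ∑ i, (f i a + inner ℝ (gradient (f i) a) (b - a) + L / 2 * ‖b - a‖ ^ 2) := by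
        unfold avgFun
        gcongr with i
        exact (hL i).le_add_inner_gradient (hf i) hX ha hb
    _ = _ := by
        have hN : (N : ℝ) ≠ 0 := NeZero.ne _
        simp only [avgFun, average, stackedGradient, Function.const_apply, real_inner_smul_left,
          sum_inner, Finset.sum_add_distrib, Finset.sum_const, Finset.card_univ, Fintype.card_fin,
          nsmul_eq_mul]
        field_simp

theorem natCast_mul_norm_average_gradient_sub_sq_le (hL : ∀ i, LipschitzGradientOn (f i) L X)
    (hX : Convex ℝ X) {x : Fin N → Vec K} (hx : ∀ i, x i ∈ X) :
    N * ‖average (stackedGradient f (Function.const (Fin N) (average x)))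
        - average (stackedGradient f x)‖ ^ 2 ≤ L ^ 2 * consensusSq x := by
  rw [← average_sub]
  refine (natCast_mul_norm_average_sq_le _).trans ?_
  refine (stackedSq_stackedGradient_sub_le hL (fun _ => average_mem hX hx) hx).trans_eq ?_
  rw [stackedSq_sub_comm]
  rfl

/-- Each agent moves against `y_i`; replacing `y_i` by `g` costs two Young inequalities, one for
`g - ȳ` with weight `p` and one for `ȳ - y_i` with weight `b`. -/
theorem natCast_mul_inner_average_direction_le (hX : IsCompact X) (hs : ∀ i, s.x i ∈ X)
    (g : Vec K) {p b : ℝ} (hp : 0 < p) (hb : 0 < b) :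
    N * inner ℝ g (average (direction X α s)) ≤ p / 2 * (N * ‖g - average s.y‖ ^ 2)
      + b / 2 * consensusSq s.y
      + (1 / (2 * p) + 1 / (2 * b) - 1 / (2 * α)) * stackedSq (direction X α s) := by
  set d := direction X α s
  have hagent : ∀ i, inner ℝ g (d i) ≤ p / 2 * ‖g - average s.y‖ ^ 2
      + b / 2 * ‖s.y i - average s.y‖ ^ 2
      + (1 / (2 * p) + 1 / (2 * b) - 1 / (2 * α)) * ‖d i‖ ^ 2 := by
    intro i
    have hmean := real_inner_le_add_mul_norm_sq hp (g - average s.y) (d i)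
    have hlocal := real_inner_le_add_mul_norm_sq hb (average s.y - s.y i) (d i)
    have hprox : inner ℝ (s.y i) (d i) ≤ -(1 / (2 * α)) * ‖d i‖ ^ 2 :=
      inner_proxStep_sub_le hX (hs i) α (s.y i)
    rw [norm_sub_rev] at hlocal
    simp only [inner_sub_left] at hmean hlocal
    linarith
  calc N * inner ℝ g (average d) = ∑ i, inner ℝ g (d i) := natCast_mul_inner_average g d
    _ ≤ _ := Finset.sum_le_sum fun i _ => hagent i
    _ = _ := by
        simp only [Finset.sum_add_distrib, ← Finset.mul_sum, Finset.sum_const, Finset.card_univ,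
          Fintype.card_fin, nsmul_eq_mul, consensusSq, stackedSq]

theorem natCast_mul_avgFun_innerStep_le (hW : W ∈ doublyStochastic ℝ (Fin N))
    (hL : ∀ i, LipschitzGradientOn (f i) L X) (hL₀ : 0 ≤ L)
    (hf : ∀ i, ∀ x ∈ X, DifferentiableAt ℝ (f i) x) (hXc : Convex ℝ X) (hXk : IsCompact X)
    (hβ : β ∈ Set.Icc 0 1) (hs : ∀ i, s.x i ∈ X) (ht : s.Tracks f) {p b : ℝ} (hp : 0 < p)
    (hb : 0 < b) :
    N * avgFun f (average (innerStep f W X α β s).x) ≤ N * avgFun f (average s.x)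
      + β * (p / 2 * (L ^ 2 * consensusSq s.x) + b / 2 * consensusSq s.y
        + (1 / (2 * p) + 1 / (2 * b) - 1 / (2 * α)) * stackedSq (direction X α s))
      + L / 2 * (β ^ 2 * stackedSq (direction X α s)) := by
  obtain ⟨hrow, hcol⟩ := mem_doublyStochastic_iff_mem_rowStochastic_and_mem_colStochastic.1 hW
  set d := direction X α s
  set g := average (stackedGradient f (Function.const (Fin N) (average s.x)))
  have hmodel := avgFun_le hL hf hXc (average_mem hXc hs)
    (average_mem hXc (innerStep_x_mem (f := f) (α := α) hrow hXc hXk hβ hs))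
  rw [average_innerStep_x hcol, add_sub_cancel_left, real_inner_smul_right, norm_smul, mul_pow,
    Real.norm_eq_abs, sq_abs] at hmodel
  have hinner : N * inner ℝ g (average d) ≤ p / 2 * (L ^ 2 * consensusSq s.x)
      + b / 2 * consensusSq s.y + (1 / (2 * p) + 1 / (2 * b) - 1 / (2 * α)) * stackedSq d := by
    refine (natCast_mul_inner_average_direction_le hXk hs g hp hb).trans ?_
    rw [ht]
    gcongr p / 2 * ?_ + _ + _
    exact natCast_mul_norm_average_gradient_sub_sq_le hL hXc hs
  rw [average_innerStep_x hcol]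
  calc N * avgFun f (average s.x + β • average d)
      ≤ N * (avgFun f (average s.x) + β * inner ℝ g (average d)
          + L / 2 * (β ^ 2 * ‖average d‖ ^ 2)) := by gcongr
    _ = N * avgFun f (average s.x) + β * (N * inner ℝ g (average d))
          + L / 2 * (β ^ 2 * (N * ‖average d‖ ^ 2)) := by ring
    _ ≤ _ := by
        gcongr
        · exact hβ.1
        · exact natCast_mul_norm_average_sq_le d

end InnerStep

namespace Input

variable {N K : ℕ} {M : Input N K} {fLow : ℝ} {t T : ℕ} {s : State N K}

/-- The rate `1 - (1 + γ) η²` at which mixing contracts the consensus error. -/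
noncomputable def consensusRate (M : Input N K) : ℝ := 1 - (1 + M.γ) * M.η ^ 2

/-- The rate `1 - (1 + ξ) η²` at which mixing contracts the tracking error. -/
noncomputable def trackingRate (M : Input N K) : ℝ := 1 - (1 + M.ξ) * M.η ^ 2

/-- The weight of the tracking error in the potential. -/
noncomputable def trackingWeight (M : Input N K) (t : ℕ) : ℝ :=
  M.consensusRate / (32 * (1 + 1 / M.ξ) * M.Lhat t ^ 2)

/-- The amount by which one inner iteration of stage `t` from the state `s` is guaranteed to
decrease the potential. -/
noncomputable def decrease (M : Input N K) (t : ℕ) (s : State N K) : ℝ :=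
  1 / (8 * N) * (1 / M.α t) * stackedSq (direction (M.X t) (M.α t) s)
    + M.consensusRate / 2 * consensusSq s.x
    + M.trackingWeight t * M.trackingRate / 2 * consensusSq s.y

/-- The guaranteed decrease of the potential over all inner iterations of stage `t`. -/
noncomputable def stageDecrease (M : Input N K) (t : ℕ) : ℝ :=
  ∑ r ∈ Finset.range (M.R t), M.decrease t (M.iter t r)

/-- The standing assumptions on a run: those on the problem, a doubly stochastic weight matrix that
contracts with positive rates, and nested feasible sets the first of which holds the initial
points. -/
structure Admissible (M : Input N K) (fLow : ℝ) : Prop where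
  problem : ProblemAssumption M.f M.Lip fLow
  weights : M.W ∈ doublyStochastic ℝ (Fin N)
  γ_pos : 0 < M.γ
  ξ_pos : 0 < M.ξ
  consensusRate_pos : 0 < M.consensusRate
  trackingRate_pos : 0 < M.trackingRate
  v_zero : 0 ≤ M.v 0
  v_mono : Monotone M.v
  x₀_mem : ∀ i, M.x₀ i ∈ M.X 1

/-- The invariants of the states visited in stage `t`. -/
structure Feasible (M : Input N K) (t : ℕ) (s : State N K) : Prop where
  mem : ∀ i, s.x i ∈ M.X t
  tracks : s.Tracks M.f

theorem isCompact_X (M : Input N K) (t : ℕ) : IsCompact (M.X t) := isCompact_closedBall _ _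

theorem convex_X (M : Input N K) (t : ℕ) : Convex ℝ (M.X t) := convex_closedBall _ _

theorem lip_le_Lhat (M : Input N K) (t : ℕ) (i : Fin N) : M.Lip i (M.X t) ≤ M.Lhat t :=
  le_ciSup (f := fun i => M.Lip i (M.X t)) (Set.finite_range _).bddAbove i

theorem iter_succ (M : Input N K) (t r : ℕ) :
    M.iter t (r + 1) = M.stageStep t (M.iter t r) :=
  Function.iterate_succ_apply' _ _ _

theorem afterStages_succ (M : Input N K) (t : ℕ) :
    M.afterStages (t + 1) = M.iter (t + 1) (M.R (t + 1)) := rfl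

theorem rounds_iter (M : Input N K) (t r : ℕ) :
    (M.iter t r).rounds = (M.afterStages (t - 1)).rounds + r := by
  induction r with
  | zero => rfl
  | succ r ih => rw [iter_succ, ← add_assoc, ← ih]; rfl

theorem rounds_afterStages (M : Input N K) (T : ℕ) :
    (M.afterStages T).rounds = ∑ t ∈ Finset.Icc 1 T, M.R t := by
  induction T with
  | zero => rfl
  | succ T ih =>
    rw [afterStages_succ, rounds_iter, Finset.sum_Icc_succ_top (by omega), ← ih,
      Nat.add_sub_cancel]

theorem one_div_ε_mul_sum (M : Input N K) (T : ℕ) :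
    1 / M.ε * ∑ t ∈ Finset.Icc 1 T, 1 / M.α t
      = ∑ t ∈ Finset.Icc 1 T, 1 / (M.ε * M.α t) := by
  simp_rw [Finset.mul_sum, one_div_mul_one_div]

theorem le_rounds_afterStages (M : Input N K) (T : ℕ) :
    1 / M.ε * ∑ t ∈ Finset.Icc 1 T, 1 / M.α t ≤ (M.afterStages T).rounds := by
  rw [one_div_ε_mul_sum, rounds_afterStages, Nat.cast_sum]
  exact Finset.sum_le_sum fun t _ => Nat.le_ceil _

theorem rounds_afterStages_eq_of_forall_nat
    (h : ∀ t ∈ Finset.Icc 1 T, ∃ m : ℕ, 1 / (M.ε * M.α t) = m) :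
    ((M.afterStages T).rounds : ℝ) = 1 / M.ε * ∑ t ∈ Finset.Icc 1 T, 1 / M.α t := by
  rw [one_div_ε_mul_sum, rounds_afterStages, Nat.cast_sum]
  refine Finset.sum_congr rfl fun t ht => ?_
  obtain ⟨m, hm⟩ := h t ht
  rw [R, hm, Nat.ceil_natCast]

/-- The ceiling is at least its argument, in which the factor `T` cancels. -/
theorem IsStageNumber.mul_le_sum_sq_sub (hT : M.IsStageNumber fLow T) (hε : 0 < M.ε) :
    128 / M.ε * (M.initialPotential - fLow)
      ≤ ∑ t ∈ Finset.Icc 1 T, (M.v t - M.v (t - 1)) ^ 2 := by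
  obtain ⟨hTpos, hTeq⟩ := hT
  have hTpos' : (0 : ℝ) < T := Nat.cast_pos.2 hTpos
  set S := ∑ t ∈ Finset.Icc 1 T, (M.v t - M.v (t - 1)) ^ 2
  set P := M.initialPotential - fLow
  have hS : 0 < S := by
    refine (Finset.sum_nonneg fun _ _ => sq_nonneg _).lt_of_ne fun (h : 0 = S) => hTpos.ne' ?_
    simpa [← h] using hTeq
  have hceil : 1 / M.ε * (128 * P / (1 / (T : ℝ) * S)) ≤ T :=
    (Nat.le_ceil _).trans_eq (congrArg Nat.cast hTeq.symm)
  have hratio : 1 / M.ε * (128 * P / (1 / (T : ℝ) * S)) = T * (128 / M.ε * P / S) := by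
    field_simp
  rw [hratio, mul_le_iff_le_one_right hTpos', div_le_one hS] at hceil
  exact hceil

namespace Admissible

theorem lipschitzGradientOn_X (hM : M.Admissible fLow) (t : ℕ) (i : Fin N) :
    LipschitzGradientOn (M.f i) (M.Lhat t) (M.X t) := fun y hy z hz =>
  (hM.problem.lipschitz i _ (M.isCompact_X t) y hy z hz).trans
    (mul_le_mul_of_nonneg_right (M.lip_le_Lhat t i) (norm_nonneg _))

theorem differentiable (hM : M.Admissible fLow) (i : Fin N) : Differentiable ℝ (M.f i) :=
  (hM.problem.contDiff i).differentiable one_ne_zero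

theorem X_mono (hM : M.Admissible fLow) : Monotone M.X := fun _ _ h =>
  Metric.closedBall_subset_closedBall (hM.v_mono h)

theorem consensusRate_le_one (hM : M.Admissible fLow) : M.consensusRate ≤ 1 :=
  sub_le_self _ (mul_nonneg (by linarith [hM.γ_pos]) (sq_nonneg _))

theorem trackingRate_le_one (hM : M.Admissible fLow) : M.trackingRate ≤ 1 :=
  sub_le_self _ (mul_nonneg (by linarith [hM.ξ_pos]) (sq_nonneg _))

theorem η_sq_le_one (hM : M.Admissible fLow) : M.η ^ 2 ≤ 1 := by
  have hrate : (1 + M.γ) * M.η ^ 2 < 1 := sub_pos.1 hM.consensusRate_pos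
  nlinarith [mul_nonneg hM.γ_pos.le (sq_nonneg M.η)]

theorem lt_potential (hM : M.Admissible fLow) (x y : Fin N → Vec K) (t : ℕ) :
    fLow < M.potential x y t := by
  have hx := consensusSq_nonneg x
  have hy : 0 ≤ M.trackingWeight t * consensusSq y := by
    have := hM.consensusRate_pos
    have := hM.ξ_pos
    have := consensusSq_nonneg y
    unfold trackingWeight
    positivity
  have h : fLow < avgFun M.f (average x) := hM.problem.lower _
  change fLow < avgFun M.f (average x) + consensusSq x + M.trackingWeight t * consensusSq y
  linarith

theorem feasible_stageStep (hM : M.Admissible fLow) (hs : M.Feasible t s) :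
    M.Feasible t (M.stageStep t s) := by
  obtain ⟨hrow, hcol⟩ :=
    mem_doublyStochastic_iff_mem_rowStochastic_and_mem_colStochastic.1 hM.weights
  exact ⟨innerStep_x_mem hrow (M.convex_X t) (M.isCompact_X t) (by norm_num) hs.mem,
    hs.tracks.innerStep hcol⟩

theorem feasible_iterate (hM : M.Admissible fLow) (hs : M.Feasible t s) (r : ℕ) :
    M.Feasible t ((M.stageStep t)^[r] s) := by
  induction r with
  | zero => exact hs
  | succ r ih =>
    rw [Function.iterate_succ_apply']
    exact hM.feasible_stageStep ih

theorem feasible_afterStages (hM : M.Admissible fLow) (t : ℕ) :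
    M.Feasible (t + 1) (M.afterStages t) := by
  induction t with
  | zero => exact ⟨hM.x₀_mem, rfl⟩
  | succ t ih =>
    have h := hM.feasible_iterate ih (M.R (t + 1))
    exact ⟨fun i => hM.X_mono (Nat.le_succ _) (h.mem i), h.tracks⟩

theorem feasible_iter (hM : M.Admissible fLow) (ht : 1 ≤ t) (r : ℕ) :
    M.Feasible t (M.iter t r) := by
  obtain ⟨t, rfl⟩ := Nat.exists_eq_add_of_le' ht
  exact hM.feasible_iterate (hM.feasible_afterStages t) r

theorem average_iter_sub (hM : M.Admissible fLow) (t r : ℕ) :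
    average (M.iter t r).x - average (M.afterStages (t - 1)).x
      = ∑ q ∈ Finset.range r,
          (1 / 2 : ℝ) • average (direction (M.X t) (M.α t) (M.iter t q)) := by
  have hcol := (mem_doublyStochastic_iff_mem_rowStochastic_and_mem_colStochastic.1 hM.weights).2
  induction r with
  | zero => simp [iter]
  | succ r ih =>
    rw [iter_succ, stageStep, average_innerStep_x hcol, Finset.sum_range_succ, ← ih]
    abel

theorem add_mul_le_sum_sq_sub (hM : M.Admissible fLow) (hε : 0 < M.ε)
    (hε' : M.ε < 2 * M.consensusRate) (hT : M.IsStageNumber fLow T) :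
    (2 / M.ε + 2 / M.consensusRate + 1) * (M.initialPotential - fLow)
      ≤ ∑ t ∈ Finset.Icc 1 T, (M.v t - M.v (t - 1)) ^ 2 := by
  have hκ := hM.consensusRate_pos
  have hP : 0 < M.initialPotential - fLow := sub_pos.2 (hM.lt_potential _ _ _)
  have hrate : 2 / M.consensusRate ≤ 4 / M.ε := by
    rw [div_le_div_iff₀ hκ hε]
    linarith
  have hone : 1 ≤ 2 / M.ε := by
    rw [one_le_div hε]
    linarith [hM.consensusRate_le_one]
  refine le_trans ?_ (hT.mul_le_sum_sq_sub hε)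
  gcongr
  calc 2 / M.ε + 2 / M.consensusRate + 1 ≤ 2 / M.ε + 4 / M.ε + 2 / M.ε := by gcongr
    _ = 8 / M.ε := by ring
    _ ≤ 128 / M.ε := by
        gcongr
        norm_num

theorem eight_mul_mul_le_gapConst_mul (hM : M.Admissible fLow) (hε : 0 < M.ε) :
    8 * N * (M.initialPotential - fLow) * M.ε
      ≤ M.gapConst * (M.initialPotential - fLow) * M.ε := by
  have hP : 0 < M.initialPotential - fLow := sub_pos.2 (hM.lt_potential _ _ _)
  gcongr
  calc 8 * (N : ℝ) ≤ 32 * N := by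
        gcongr
        norm_num
    _ ≤ M.gapConst := (le_max_left _ _).trans (le_max_left _ _)

variable [NeZero N]

theorem one_le_Lhat (hM : M.Admissible fLow) (t : ℕ) : 1 ≤ M.Lhat t :=
  (hM.problem.one_le 0 _ (M.isCompact_X t)).trans (M.lip_le_Lhat t 0)

theorem Lhat_mono (hM : M.Admissible fLow) : Monotone M.Lhat := fun s t hst =>
  ciSup_le fun i => (hM.problem.mono i _ _ (M.isCompact_X s) (M.isCompact_X t)
    (hM.X_mono hst)).trans (M.lip_le_Lhat t i)

theorem Lhat_pos (hM : M.Admissible fLow) (t : ℕ) : 0 < M.Lhat t :=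
  one_pos.trans_le (hM.one_le_Lhat t)

theorem trackingWeight_pos (hM : M.Admissible fLow) (t : ℕ) : 0 < M.trackingWeight t := by
  have := hM.consensusRate_pos
  have := hM.ξ_pos
  have := hM.Lhat_pos t
  unfold trackingWeight
  positivity

theorem one_div_α (hM : M.Admissible fLow) (t : ℕ) :
    1 / M.α t = max (max (4 * M.Lhat t + 8 * N / M.γ + 10 * N)
      (64 * (1 + 1 / M.ξ) * M.Lhat t ^ 2 / (N * M.consensusRate * M.trackingRate))) 1 := by
  have hκ := hM.consensusRate_pos
  have hκ' := hM.trackingRate_pos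
  have hγ := hM.γ_pos
  have hξ := hM.ξ_pos
  have hL := hM.Lhat_pos t
  have hN : (0 : ℝ) < N := Nat.cast_pos.2 (NeZero.pos N)
  have hfirst : 0 < 1 / (8 * (N : ℝ)) * (1 / (M.Lhat t / (2 * N) + (1 / M.γ + 5 / 4))) := by
    positivity
  have hsecond : 0 < N * M.consensusRate * M.trackingRate
      / (64 * (1 + 1 / M.ξ) * M.Lhat t ^ 2) := by positivity
  change 1 / min (min _ (N * M.consensusRate * M.trackingRate / _)) 1 = _
  rw [one_div_min_eq_max (lt_min hfirst hsecond) one_pos,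
    one_div_min_eq_max hfirst hsecond, one_div_one, one_div_div]
  congr 2
  field_simp
  ring

theorem Lhat_add_le_one_div_α (hM : M.Admissible fLow) (t : ℕ) :
    4 * M.Lhat t + 8 * N / M.γ + 10 * N ≤ 1 / M.α t := by
  rw [hM.one_div_α]
  exact (le_max_left _ _).trans (le_max_left _ _)

theorem ten_mul_le_one_div_α (hM : M.Admissible fLow) (t : ℕ) : 10 * N ≤ 1 / M.α t := by
  have hL := hM.Lhat_pos t
  have hγ : 0 ≤ 8 * N / M.γ := div_nonneg (by positivity) hM.γ_pos.le
  linarith [hM.Lhat_add_le_one_div_α t]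

theorem α_pos (hM : M.Admissible fLow) (t : ℕ) : 0 < M.α t :=
  one_div_pos.1 ((by simp [NeZero.pos N] : (0 : ℝ) < 10 * N).trans_le (hM.ten_mul_le_one_div_α t))

theorem two_div_le_one_div_α (hM : M.Admissible fLow) (t : ℕ) :
    2 / (N * (M.trackingWeight t * M.trackingRate)) ≤ 1 / M.α t := by
  have hκ := hM.consensusRate_pos
  have hκ' := hM.trackingRate_pos
  have hξ : 1 + 1 / M.ξ ≠ 0 := by
    have := hM.ξ_pos
    positivity
  have hL := hM.Lhat_pos t
  rw [hM.one_div_α]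
  refine le_trans (le_of_eq ?_) ((le_max_right _ _).trans (le_max_left _ _))
  unfold trackingWeight
  field_simp
  norm_num

theorem Lhat_sq_div_le_one_div_α (hM : M.Admissible fLow) (t : ℕ) :
    64 * M.Lhat t ^ 2 / (N * M.consensusRate) ≤ 1 / M.α t := by
  have hκ := hM.consensusRate_pos
  have hκ' := hM.trackingRate_pos
  have hc := hM.trackingWeight_pos t
  have hL := hM.Lhat_pos t
  have hξ : 1 ≤ 1 + 1 / M.ξ := by
    have := hM.ξ_pos
    simpa using this.le
  have hN : (0 : ℝ) < N := Nat.cast_pos.2 (NeZero.pos N)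
  have hweight : M.trackingWeight t * M.trackingRate
      ≤ M.consensusRate / (32 * 1 * M.Lhat t ^ 2) * 1 := by
    unfold trackingWeight
    gcongr
    exact hM.trackingRate_le_one
  calc 64 * M.Lhat t ^ 2 / (N * M.consensusRate)
      = 2 / (N * (M.consensusRate / (32 * 1 * M.Lhat t ^ 2) * 1)) := by
        field_simp
        norm_num
    _ ≤ 2 / (N * (M.trackingWeight t * M.trackingRate)) := by gcongr
    _ ≤ 1 / M.α t := hM.two_div_le_one_div_α t

theorem rounds_afterStages_lt (hM : M.Admissible fLow) (hε : 0 < M.ε) (hT : 0 < T) :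
    ((M.afterStages T).rounds : ℝ) < 1 / M.ε * ∑ t ∈ Finset.Icc 1 T, 1 / M.α t + T := by
  have hceil : ∀ t, (M.R t : ℝ) < 1 / (M.ε * M.α t) + 1 := fun t =>
    Nat.ceil_lt_add_one (one_div_nonneg.2 (mul_pos hε (hM.α_pos t)).le)
  rw [one_div_ε_mul_sum, rounds_afterStages, Nat.cast_sum]
  calc ∑ t ∈ Finset.Icc 1 T, (M.R t : ℝ)
      < ∑ t ∈ Finset.Icc 1 T, (1 / (M.ε * M.α t) + 1) :=
        Finset.sum_lt_sum_of_nonempty (Finset.nonempty_Icc.2 hT) fun t _ => hceil t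
    _ = ∑ t ∈ Finset.Icc 1 T, 1 / (M.ε * M.α t) + T := by simp [Finset.sum_add_distrib]

theorem consensusSq_stageStep_x_le (hM : M.Admissible fLow) (t : ℕ) (s : State N K) :
    consensusSq (M.stageStep t s).x ≤ (1 - M.consensusRate) * consensusSq s.x
      + (1 + 1 / M.γ) / 4 * stackedSq (direction (M.X t) (M.α t) s) := by
  set V := stackedSq (direction (M.X t) (M.α t) s)
  have hγ := hM.γ_pos
  have hV₀ : 0 ≤ V := stackedSq_nonneg _
  calc consensusSq (M.stageStep t s).x
      ≤ M.η ^ 2 * ((1 + M.γ) * consensusSq s.x + (1 + 1 / M.γ) * ((1 / 2) ^ 2 * V)) :=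
        consensusSq_innerStep_x_le hM.weights hγ
    _ = (1 - M.consensusRate) * consensusSq s.x + M.η ^ 2 * ((1 + 1 / M.γ) / 4 * V) := by
        unfold consensusRate
        ring
    _ ≤ _ := by
        gcongr _ + ?_
        exact mul_le_of_le_one_left (by positivity) hM.η_sq_le_one

theorem trackingWeight_mul_consensusSq_stageStep_y_le (hM : M.Admissible fLow)
    (hs : M.Feasible t s) :
    M.trackingWeight t * consensusSq (M.stageStep t s).y
      ≤ M.trackingWeight t * (1 - M.trackingRate) * consensusSq s.y
        + M.consensusRate / 4 * consensusSq s.x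
        + M.consensusRate / 64 * stackedSq (direction (M.X t) (M.α t) s) := by
  set V := stackedSq (direction (M.X t) (M.α t) s)
  have hξ := hM.ξ_pos
  have hL := hM.Lhat_pos t
  have hweight : M.trackingWeight t * ((1 + 1 / M.ξ) * M.Lhat t ^ 2) = M.consensusRate / 32 := by
    unfold trackingWeight
    field_simp
  calc M.trackingWeight t * consensusSq (M.stageStep t s).y
      ≤ M.trackingWeight t * ((1 + M.ξ) * (M.η ^ 2 * consensusSq s.y) + (1 + 1 / M.ξ) *
          (M.Lhat t ^ 2 * (8 * consensusSq s.x + 2 * ((1 / 2) ^ 2 * V)))) :=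
        mul_le_mul_of_nonneg_left
          (consensusSq_innerStep_y_le hM.weights (M.convex_X t) (M.isCompact_X t)
            (hM.lipschitzGradientOn_X t) (by norm_num) hs.mem hξ)
          (hM.trackingWeight_pos t).le
    _ = M.trackingWeight t * (1 - M.trackingRate) * consensusSq s.y
          + M.trackingWeight t * ((1 + 1 / M.ξ) * M.Lhat t ^ 2)
            * (8 * consensusSq s.x + V / 2) := by
        unfold trackingRate
        ring
    _ = _ := by
        rw [hweight]
        ring

theorem avgFun_stageStep_le (hM : M.Admissible fLow) (hs : M.Feasible t s) :
    avgFun M.f (average (M.stageStep t s).x) ≤ avgFun M.f (average s.x)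
      + M.consensusRate / 4 * consensusSq s.x
      + M.trackingWeight t * M.trackingRate / 2 * consensusSq s.y
      + 1 / N * (M.Lhat t / 8 - 47 / 256 * (1 / M.α t))
        * stackedSq (direction (M.X t) (M.α t) s) := by
  set V := stackedSq (direction (M.X t) (M.α t) s)
  set κ := M.consensusRate
  set w := M.trackingWeight t * M.trackingRate
  have hL := hM.Lhat_pos t
  have hκ₀ : 0 < κ := hM.consensusRate_pos
  have hw₀ : 0 < w := mul_pos (hM.trackingWeight_pos t) hM.trackingRate_pos
  have hN : (0 : ℝ) < N := Nat.cast_pos.2 (NeZero.pos N)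
  have hV₀ : 0 ≤ V := stackedSq_nonneg _
  have hstep := natCast_mul_avgFun_innerStep_le (α := M.α t) hM.weights
    (hM.lipschitzGradientOn_X t) hL.le (fun i x _ => hM.differentiable i x) (M.convex_X t)
    (M.isCompact_X t) (β := 1 / 2) (by norm_num) hs.mem hs.tracks
    (p := N * κ / M.Lhat t ^ 2) (b := 2 * N * w) (by positivity) (by positivity)
  have hcoeff : 1 / (2 * (N * κ / M.Lhat t ^ 2)) + 1 / (2 * (2 * N * w)) - 1 / (2 * M.α t)
      ≤ -(47 / 128 * (1 / M.α t)) := by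
    have hp : 1 / (2 * (N * κ / M.Lhat t ^ 2)) = 1 / 128 * (64 * M.Lhat t ^ 2 / (N * κ)) := by
      field_simp
      norm_num
    have hb : 1 / (2 * (2 * N * w)) = 1 / 8 * (2 / (N * w)) := by
      field_simp
      norm_num
    have hα : 1 / (2 * M.α t) = 1 / 2 * (1 / M.α t) := by ring
    rw [hp, hb, hα]
    linarith [hM.Lhat_sq_div_le_one_div_α t, hM.two_div_le_one_div_α t]
  refine le_of_mul_le_mul_left (hstep.trans ?_) hN
  calc _ ≤ N * avgFun M.f (average s.x)
          + 1 / 2 * (N * κ / M.Lhat t ^ 2 / 2 * (M.Lhat t ^ 2 * consensusSq s.x)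
            + 2 * N * w / 2 * consensusSq s.y + -(47 / 128 * (1 / M.α t)) * V)
          + M.Lhat t / 2 * ((1 / 2) ^ 2 * V) := by gcongr
    _ = _ := by
      field_simp
      ring

theorem direction_coeff_le (hM : M.Admissible fLow) (t : ℕ) :
    1 / N * (M.Lhat t / 8 - 47 / 256 * (1 / M.α t)) + (1 + 1 / M.γ) / 4 + M.consensusRate / 64
      ≤ -(1 / (8 * N) * (1 / M.α t)) := by
  have hN : (0 : ℝ) < N := Nat.cast_pos.2 (NeZero.pos N)
  have hL := hM.Lhat_pos t
  have hγ : 0 < N / M.γ := div_pos hN hM.γ_pos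
  have hκ : N * M.consensusRate ≤ N := mul_le_of_le_one_right hN.le hM.consensusRate_le_one
  have hα := hM.Lhat_add_le_one_div_α t
  rw [mul_div_assoc] at hα
  refine le_of_mul_le_mul_left ?_ hN
  calc _ = M.Lhat t / 8 - 47 / 256 * (1 / M.α t) + (N + N / M.γ) / 4
          + N * M.consensusRate / 64 := by field_simp
    _ ≤ -(1 / 8 * (1 / M.α t)) := by linarith
    _ = _ := by field_simp

theorem potential_stageStep_add_decrease_le (hM : M.Admissible fLow) (hs : M.Feasible t s) :
    M.potential (M.stageStep t s).x (M.stageStep t s).y t + M.decrease t s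
      ≤ M.potential s.x s.y t := by
  have hcoeff := mul_le_mul_of_nonneg_right (hM.direction_coeff_le t)
    (stackedSq_nonneg (direction (M.X t) (M.α t) s))
  have hx := hM.consensusSq_stageStep_x_le t s
  have hy := hM.trackingWeight_mul_consensusSq_stageStep_y_le hs
  have hf := hM.avgFun_stageStep_le hs
  change avgFun M.f _ + consensusSq _ + M.trackingWeight t * consensusSq _ + M.decrease t s
    ≤ avgFun M.f _ + consensusSq _ + M.trackingWeight t * consensusSq _
  unfold decrease
  linarith

theorem average_afterStages_mem (hM : M.Admissible fLow) (t : ℕ) :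
    average (M.afterStages t).x ∈ M.X t := by
  cases t with
  | zero => exact Metric.mem_closedBall_self hM.v_zero
  | succ t =>
    exact average_mem (M.convex_X _) (hM.feasible_iter (Nat.le_add_left 1 t) (M.R (t + 1))).mem

theorem add_le_decrease (hM : M.Admissible fLow) (t : ℕ) (s : State N K) :
    1 / (8 * N) * (1 / M.α t) * stackedSq (direction (M.X t) (M.α t) s)
      + M.consensusRate / 2 * consensusSq s.x ≤ M.decrease t s := by
  have := hM.trackingRate_pos
  have := hM.trackingWeight_pos t
  have := consensusSq_nonneg s.y
  exact le_add_of_nonneg_right (by positivity)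

theorem decrease_nonneg (hM : M.Admissible fLow) (t : ℕ) (s : State N K) :
    0 ≤ M.decrease t s := by
  have := hM.α_pos t
  have := hM.consensusRate_pos
  have := stackedSq_nonneg (direction (M.X t) (M.α t) s)
  have := consensusSq_nonneg s.x
  exact le_trans (by positivity) (hM.add_le_decrease t s)

theorem stageDecrease_nonneg (hM : M.Admissible fLow) (t : ℕ) : 0 ≤ M.stageDecrease t :=
  Finset.sum_nonneg fun _ _ => hM.decrease_nonneg t _

theorem potential_antitone (hM : M.Admissible fLow) (x y : Fin N → Vec K) :
    Antitone (M.potential x y) := by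
  intro t₁ t₂ ht
  have hκ := hM.consensusRate_pos
  have hξ := hM.ξ_pos
  have hL := hM.Lhat_pos t₁
  have hweight : M.trackingWeight t₂ ≤ M.trackingWeight t₁ := by
    unfold trackingWeight
    gcongr
    exact hM.Lhat_mono ht
  change _ + M.trackingWeight t₂ * _ ≤ _ + M.trackingWeight t₁ * _
  gcongr
  exact consensusSq_nonneg y

theorem potential_iter_add_sum_le (hM : M.Admissible fLow) (ht : 1 ≤ t) (r : ℕ) :
    M.potential (M.iter t r).x (M.iter t r).y t
      + ∑ q ∈ Finset.range r, M.decrease t (M.iter t q)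
      ≤ M.potential (M.afterStages (t - 1)).x (M.afterStages (t - 1)).y t := by
  induction r with
  | zero => simp [iter]
  | succ r ih =>
    have hstep := hM.potential_stageStep_add_decrease_le (hM.feasible_iter ht r)
    rw [iter_succ, Finset.sum_range_succ]
    linarith

theorem potential_afterStages_add_sum_le (hM : M.Admissible fLow) (T : ℕ) :
    M.potential (M.afterStages T).x (M.afterStages T).y (T + 1)
      + ∑ t ∈ Finset.Icc 1 T, M.stageDecrease t ≤ M.initialPotential := by
  induction T with
  | zero => simp [afterStages, initialPotential]
  | succ T ih =>
    have hstage : M.potential (M.afterStages (T + 1)).x (M.afterStages (T + 1)).y (T + 1)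
        + M.stageDecrease (T + 1)
        ≤ M.potential (M.afterStages T).x (M.afterStages T).y (T + 1) :=
      hM.potential_iter_add_sum_le (Nat.le_add_left 1 T) (M.R (T + 1))
    have hnext := hM.potential_antitone (M.afterStages (T + 1)).x (M.afterStages (T + 1)).y
      (Nat.le_succ (T + 1))
    rw [Finset.sum_Icc_succ_top (Nat.le_add_left 1 T)]
    linarith

theorem sum_stageDecrease_lt (hM : M.Admissible fLow) (T : ℕ) :
    ∑ t ∈ Finset.Icc 1 T, M.stageDecrease t < M.initialPotential - fLow := by
  have h := hM.potential_afterStages_add_sum_le T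
  have hlow := hM.lt_potential (M.afterStages T).x (M.afterStages T).y (T + 1)
  linarith

theorem stageDecrease_le (hM : M.Admissible fLow) (ht : 1 ≤ t) :
    M.stageDecrease t ≤ M.initialPotential - fLow :=
  (Finset.single_le_sum (fun q _ => hM.stageDecrease_nonneg q)
    (Finset.mem_Icc.2 ⟨ht, le_rfl⟩)).trans (hM.sum_stageDecrease_lt t).le

/-- An interior proximal point is a gradient step, so the displacements measure `‖y‖²`. -/
theorem gap_le_of_forall_mem_interior (hM : M.Admissible fLow)
    (hs : ∀ i, proxStep (M.X t) (M.α t) (s.y i) (s.x i) ∈ interior (M.X t)) :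
    stackedSq s.y + consensusSq s.x + consensusSq s.y
      ≤ 8 * N * (1 / M.α t) * M.decrease t s := by
  have hN : (0 : ℝ) < N := Nat.cast_pos.2 (NeZero.pos N)
  have hα := hM.α_pos t
  have hκ := hM.consensusRate_pos
  set w := M.trackingWeight t * M.trackingRate with hw
  have hw₀ : 0 < w := mul_pos (hM.trackingWeight_pos t) hM.trackingRate_pos
  have hdir : direction (M.X t) (M.α t) s = (-M.α t) • s.y := by
    ext1 i
    rw [Pi.smul_apply, neg_smul]
    exact proxStep_sub_eq_neg_smul (M.isCompact_X t) hα.ne' (hs i)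
  have hx : 1 ≤ 4 * N * (1 / M.α t) * M.consensusRate := by
    have h := (div_le_iff₀ (mul_pos hN hκ)).1 (hM.Lhat_sq_div_le_one_div_α t)
    linarith [one_le_pow₀ (n := 2) (hM.one_le_Lhat t)]
  have hy : 1 ≤ 4 * N * (1 / M.α t) * w := by
    have h := (div_le_iff₀ (mul_pos hN hw₀)).1 (hM.two_div_le_one_div_α t)
    linarith
  calc stackedSq s.y + consensusSq s.x + consensusSq s.y
      ≤ stackedSq s.y + 4 * N * (1 / M.α t) * M.consensusRate * consensusSq s.x
          + 4 * N * (1 / M.α t) * w * consensusSq s.y := by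
        gcongr
        · exact le_mul_of_one_le_left (consensusSq_nonneg _) hx
        · exact le_mul_of_one_le_left (consensusSq_nonneg _) hy
    _ = 8 * N * (1 / M.α t) * M.decrease t s := by
        rw [decrease, hdir, stackedSq_smul, ← hw]
        field_simp
        ring

theorem avgGap_le_of_forall_mem_interior (hM : M.Admissible fLow) (hε : 0 < M.ε) (ht : 1 ≤ t)
    (hint : ∀ r < M.R t, ∀ i,
      proxStep (M.X t) (M.α t) ((M.iter t r).y i) ((M.iter t r).x i) ∈ interior (M.X t)) :
    M.avgGap t ≤ 8 * N * (M.initialPotential - fLow) * M.ε := by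
  have hα := hM.α_pos t
  have hD := hM.stageDecrease_nonneg t
  have hR : 1 / (M.R t : ℝ) ≤ M.ε * M.α t := by
    have h := one_div_le_one_div_of_le (by positivity) (Nat.le_ceil (1 / (M.ε * M.α t)))
    rwa [one_div_one_div] at h
  calc M.avgGap t
      ≤ 1 / M.R t * ∑ r ∈ Finset.range (M.R t),
          8 * N * (1 / M.α t) * M.decrease t (M.iter t r) := by
        unfold avgGap
        gcongr with r hr
        exact hM.gap_le_of_forall_mem_interior (hint r (Finset.mem_range.1 hr))
    _ = 1 / M.R t * (8 * N * (1 / M.α t) * M.stageDecrease t) := by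
        rw [← Finset.mul_sum, stageDecrease]
    _ ≤ M.ε * M.α t * (8 * N * (1 / M.α t) * M.stageDecrease t) := by gcongr
    _ = 8 * N * M.stageDecrease t * M.ε := by
        field_simp
    _ ≤ 8 * N * (M.initialPotential - fLow) * M.ε := by
        gcongr
        exact hM.stageDecrease_le ht

theorem norm_average_iter_sub_sq_le (hM : M.Admissible fLow) (hε : 0 < M.ε) {r : ℕ}
    (hr : r < M.R t) :
    M.ε / 2 * ‖average (M.iter t r).x - average (M.afterStages (t - 1)).x‖ ^ 2
      ≤ ∑ q ∈ Finset.range r, M.decrease t (M.iter t q) := by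
  have hN : (0 : ℝ) < N := Nat.cast_pos.2 (NeZero.pos N)
  have hα := hM.α_pos t
  set d := fun q => direction (M.X t) (M.α t) (M.iter t q)
  have hr' : M.ε * r ≤ 1 / M.α t := by
    have h : (r : ℝ) < 1 / (M.ε * M.α t) := Nat.lt_ceil.1 hr
    rw [lt_div_iff₀ (mul_pos hε hα)] at h
    rw [le_div_iff₀ hα]
    linarith
  have hsum : ‖∑ q ∈ Finset.range r, (1 / 2 : ℝ) • average (d q)‖ ^ 2
      ≤ r * ∑ q ∈ Finset.range r, 1 / 4 * (stackedSq (d q) / N) := by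
    calc _ ≤ (∑ q ∈ Finset.range r, ‖(1 / 2 : ℝ) • average (d q)‖) ^ 2 := by
          gcongr
          exact norm_sum_le _ _
      _ ≤ r * ∑ q ∈ Finset.range r, ‖(1 / 2 : ℝ) • average (d q)‖ ^ 2 := by
          simpa using sq_sum_le_card_mul_sum_sq (s := Finset.range r)
            (f := fun q => ‖(1 / 2 : ℝ) • average (d q)‖)
      _ ≤ _ := by
          gcongr with q
          rw [norm_smul_of_nonneg one_half_pos.le]
          linarith [(le_div_iff₀' hN).2 (natCast_mul_norm_average_sq_le (d q))]
  rw [hM.average_iter_sub]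
  calc M.ε / 2 * ‖∑ q ∈ Finset.range r, (1 / 2 : ℝ) • average (d q)‖ ^ 2
      ≤ M.ε / 2 * (r * ∑ q ∈ Finset.range r, 1 / 4 * (stackedSq (d q) / N)) := by gcongr
    _ = M.ε * r * ∑ q ∈ Finset.range r, 1 / (8 * N) * stackedSq (d q) := by
        simp only [Finset.mul_sum]
        exact Finset.sum_congr rfl fun q _ => by ring
    _ ≤ 1 / M.α t * ∑ q ∈ Finset.range r, 1 / (8 * N) * stackedSq (d q) := by
        gcongr
        exact Finset.sum_nonneg fun q _ => mul_nonneg (by positivity) (stackedSq_nonneg _)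
    _ ≤ ∑ q ∈ Finset.range r, M.decrease t (M.iter t q) := by
        rw [Finset.mul_sum]
        refine Finset.sum_le_sum fun q _ => le_trans ?_ (hM.add_le_decrease t (M.iter t q))
        have := mul_nonneg hM.consensusRate_pos.le (consensusSq_nonneg (M.iter t q).x)
        linarith

theorem consensusRate_mul_add_norm_direction_sq_le (hM : M.Admissible fLow) (t : ℕ)
    (s : State N K) (i : Fin N) :
    M.consensusRate / 2 * ‖s.x i - average s.x‖ ^ 2
      + ‖proxStep (M.X t) (M.α t) (s.y i) (s.x i) - s.x i‖ ^ 2 ≤ M.decrease t s := by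
  have hN : (0 : ℝ) < N := Nat.cast_pos.2 (NeZero.pos N)
  have hκ := hM.consensusRate_pos
  have hcoeff : 1 ≤ 1 / (8 * (N : ℝ)) * (1 / M.α t) := by
    rw [one_div_mul_eq_div, one_le_div (by positivity)]
    linarith [hM.ten_mul_le_one_div_α t]
  have hconsensus : ‖s.x i - average s.x‖ ^ 2 ≤ consensusSq s.x :=
    norm_sq_le_stackedSq (fun j => s.x j - average s.x) i
  have hdirection : ‖proxStep (M.X t) (M.α t) (s.y i) (s.x i) - s.x i‖ ^ 2
      ≤ 1 / (8 * N) * (1 / M.α t) * stackedSq (direction (M.X t) (M.α t) s) :=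
    (norm_sq_le_stackedSq (direction (M.X t) (M.α t) s) i).trans
      (le_mul_of_one_le_left (stackedSq_nonneg _) hcoeff)
  calc _ ≤ M.consensusRate / 2 * consensusSq s.x
          + 1 / (8 * N) * (1 / M.α t) * stackedSq (direction (M.X t) (M.α t) s) := by gcongr
    _ ≤ M.decrease t s := (add_comm _ _).trans_le (hM.add_le_decrease t s)

theorem sub_le_norm_of_notMem_interior (hM : M.Admissible fLow) (t : ℕ) {u : Vec K}
    (hu : u ∉ interior (M.X t)) :
    M.v t - M.v (t - 1) ≤ ‖u - average (M.afterStages (t - 1)).x‖ := by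
  have hfar : M.v t ≤ dist u (average M.x₀) := by
    by_contra! h
    exact hu (Metric.ball_subset_interior_closedBall h)
  have hnear : dist (average (M.afterStages (t - 1)).x) (average M.x₀) ≤ M.v (t - 1) :=
    hM.average_afterStages_mem (t - 1)
  rw [← dist_eq_norm]
  linarith [dist_triangle u (average (M.afterStages (t - 1)).x) (average M.x₀)]

/-- The way from the start of the stage to the boundary splits into the drift of the average, the
consensus error and the last displacement; the decrease of the potential pays for all three. -/
theorem sq_sub_le_mul_stageDecrease (hM : M.Admissible fLow) (hε : 0 < M.ε) {r : ℕ}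
    (hr : r < M.R t) {i : Fin N}
    (hi : proxStep (M.X t) (M.α t) ((M.iter t r).y i) ((M.iter t r).x i) ∉ interior (M.X t)) :
    (M.v t - M.v (t - 1)) ^ 2
      ≤ (2 / M.ε + 2 / M.consensusRate + 1) * M.stageDecrease t := by
  have hκ := hM.consensusRate_pos
  set s := M.iter t r
  set u := proxStep (M.X t) (M.α t) (s.y i) (s.x i)
  set drift := ‖average s.x - average (M.afterStages (t - 1)).x‖
  have hlength : M.v t - M.v (t - 1)
      ≤ drift + ‖s.x i - average s.x‖ + ‖u - s.x i‖ := by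
    refine (hM.sub_le_norm_of_notMem_interior t hi).trans (le_of_eq_of_le ?_ norm_add₃_le)
    congr 1
    abel
  have hdecrease : M.ε / 2 * drift ^ 2 + M.consensusRate / 2 * ‖s.x i - average s.x‖ ^ 2
      + ‖u - s.x i‖ ^ 2 ≤ M.stageDecrease t := by
    calc _ ≤ ∑ q ∈ Finset.range r, M.decrease t (M.iter t q) + M.decrease t s := by
          linarith [hM.norm_average_iter_sub_sq_le hε hr,
            hM.consensusRate_mul_add_norm_direction_sq_le t s i]
      _ = ∑ q ∈ Finset.range (r + 1), M.decrease t (M.iter t q) :=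
          (Finset.sum_range_succ _ _).symm
      _ ≤ M.stageDecrease t :=
          Finset.sum_le_sum_of_subset_of_nonneg (Finset.range_mono hr)
            fun q _ _ => hM.decrease_nonneg t _
  calc (M.v t - M.v (t - 1)) ^ 2
      ≤ (drift + ‖s.x i - average s.x‖ + ‖u - s.x i‖) ^ 2 :=
        pow_le_pow_left₀ (sub_nonneg.2 (hM.v_mono (Nat.sub_le t 1))) hlength 2
    _ ≤ (2 / M.ε + 2 / M.consensusRate + 1) * (drift ^ 2 / (2 / M.ε)
          + ‖s.x i - average s.x‖ ^ 2 / (2 / M.consensusRate) + ‖u - s.x i‖ ^ 2 / 1) :=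
        add_add_sq_le_mul (by positivity) (by positivity) one_pos _ _ _
    _ ≤ (2 / M.ε + 2 / M.consensusRate + 1) * M.stageDecrease t := by
        gcongr
        refine le_of_eq_of_le ?_ hdecrease
        field_simp

theorem exists_avgGap_le (hM : M.Admissible fLow) (hε : 0 < M.ε)
    (hT : (2 / M.ε + 2 / M.consensusRate + 1) * (M.initialPotential - fLow)
      ≤ ∑ t ∈ Finset.Icc 1 T, (M.v t - M.v (t - 1)) ^ 2) :
    ∃ t ∈ Finset.Icc 1 T, M.avgGap t ≤ 8 * N * (M.initialPotential - fLow) * M.ε := by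
  have hκ := hM.consensusRate_pos
  by_contra! hgap
  have hradius : ∀ t ∈ Finset.Icc 1 T, (M.v t - M.v (t - 1)) ^ 2
      ≤ (2 / M.ε + 2 / M.consensusRate + 1) * M.stageDecrease t := by
    intro t ht
    have hboundary := mt (hM.avgGap_le_of_forall_mem_interior hε (Finset.mem_Icc.1 ht).1)
      (hgap t ht).not_ge
    push Not at hboundary
    obtain ⟨r, hr, i, hi⟩ := hboundary
    exact hM.sq_sub_le_mul_stageDecrease hε hr hi
  refine hT.not_gt ?_
  calc ∑ t ∈ Finset.Icc 1 T, (M.v t - M.v (t - 1)) ^ 2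
      ≤ (2 / M.ε + 2 / M.consensusRate + 1) * ∑ t ∈ Finset.Icc 1 T, M.stageDecrease t := by
        rw [Finset.mul_sum]
        exact Finset.sum_le_sum hradius
    _ < (2 / M.ε + 2 / M.consensusRate + 1) * (M.initialPotential - fLow) := by
        gcongr
        exact hM.sum_stageDecrease_lt T

end Admissible

end Input

end Magenta

theorem theorem3_general {N K : ℕ} [NeZero N] {M : Magenta.Input N K} {fLow : ℝ}
    (hM : M.Admissible fLow) (hε : 0 < M.ε) {T : ℕ}
    (hT : (2 / M.ε + 2 / M.consensusRate + 1) * (M.initialPotential - fLow)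
      ≤ ∑ t ∈ Finset.Icc 1 T, (M.v t - M.v (t - 1)) ^ 2) :
    (∃ t ∈ Finset.Icc 1 T, M.avgGap t ≤ 8 * N * (M.initialPotential - fLow) * M.ε) ∧
    (M.afterStages T).rounds = ∑ t ∈ Finset.Icc 1 T, ⌈1 / (M.ε * M.α t)⌉₊ ∧
    1 / M.ε * ∑ t ∈ Finset.Icc 1 T, 1 / M.α t ≤ ((M.afterStages T).rounds : ℝ) ∧
    ((M.afterStages T).rounds : ℝ) < 1 / M.ε * ∑ t ∈ Finset.Icc 1 T, 1 / M.α t + T ∧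
    ((∀ t ∈ Finset.Icc 1 T, ∃ m : ℕ, 1 / (M.ε * M.α t) = m) →
      ((M.afterStages T).rounds : ℝ) = 1 / M.ε * ∑ t ∈ Finset.Icc 1 T, 1 / M.α t) ∧
    1 / M.ε * ∑ t ∈ Finset.Icc 1 T, 1 / M.α t =
      1 / M.ε * ∑ t ∈ Finset.Icc 1 T,
        max (max (4 * M.Lhat t + 8 * N / M.γ + 10 * N)
          (64 * (1 + 1 / M.ξ) * M.Lhat t ^ 2 / (N * M.consensusRate * M.trackingRate))) 1 := by
  have hgap := hM.exists_avgGap_le hε hT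
  have hTpos : 0 < T := by
    obtain ⟨t, ht, -⟩ := hgap
    exact (Finset.mem_Icc.1 ht).1.trans (Finset.mem_Icc.1 ht).2
  exact ⟨hgap, M.rounds_afterStages T, M.le_rounds_afterStages T,
    hM.rounds_afterStages_lt hε hTpos, Magenta.Input.rounds_afterStages_eq_of_forall_nat,
    congrArg (1 / M.ε * ·) (Finset.sum_congr rfl fun t _ => hM.one_div_α t)⟩

theorem theorem3 {N K : ℕ} (hN : 0 < N) (G : SimpleGraph (Fin N))
    (M : Magenta.Input N K) (fLow : ℝ)
    (hprob : Magenta.ProblemAssumption M.f M.Lip fLow)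
    (hW : Magenta.WeightAssumption G M.W)
    (hγ : 0 < M.γ) (hξ : 0 < M.ξ)
    (hγη : (1 + M.γ) * M.η ^ 2 < 1) (hξη : (1 + M.ξ) * M.η ^ 2 < 1)
    (hv₀ : 0 ≤ M.v 0) (hv : Monotone M.v) (hx₀ : ∀ i, M.x₀ i ∈ M.X 1)
    (hε : 0 < M.ε) (hε' : M.ε < 2 * (1 - (1 + M.γ) * M.η ^ 2))
    (T : ℕ) (hT : M.IsStageNumber fLow T) :
    -- an approximately stationary stage occurs among the stages `1, …, T`
    (∃ t ∈ Finset.Icc 1 T,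
      M.avgGap t ≤ M.gapConst * (M.initialPotential - fLow) * M.ε) ∧
    -- number of rounds made in the stages `1, …, T`
    (M.afterStages T).rounds = ∑ t ∈ Finset.Icc 1 T, ⌈1 / (M.ε * M.α t)⌉₊ ∧
    1 / M.ε * ∑ t ∈ Finset.Icc 1 T, 1 / M.α t ≤ ((M.afterStages T).rounds : ℝ) ∧
    ((M.afterStages T).rounds : ℝ) < 1 / M.ε * ∑ t ∈ Finset.Icc 1 T, 1 / M.α t + T ∧
    ((∀ t ∈ Finset.Icc 1 T, ∃ m : ℕ, 1 / (M.ε * M.α t) = m) →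
      ((M.afterStages T).rounds : ℝ) = 1 / M.ε * ∑ t ∈ Finset.Icc 1 T, 1 / M.α t) ∧
    -- explicit form of this number
    1 / M.ε * ∑ t ∈ Finset.Icc 1 T, 1 / M.α t =
      1 / M.ε * ∑ t ∈ Finset.Icc 1 T,
        max (max (4 * M.Lhat t + 8 * N / M.γ + 10 * N)
          (64 * (1 + 1 / M.ξ) * M.Lhat t ^ 2
            / (N * (1 - (1 + M.γ) * M.η ^ 2) * (1 - (1 + M.ξ) * M.η ^ 2)))) 1 := by
  have : NeZero N := ⟨hN.ne'⟩
  have hM : M.Admissible fLow := ⟨hprob, hW.mem_doublyStochastic, hγ, hξ, sub_pos.2 hγη,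
    sub_pos.2 hξη, hv₀, hv, hx₀⟩
  obtain ⟨⟨t, ht, hgap⟩, hrounds⟩ :=
    theorem3_general hM hε (hM.add_mul_le_sum_sq_sub hε hε' hT)
  exact ⟨⟨t, ht, hgap.trans (hM.eight_mul_mul_le_gapConst_mul hε)⟩, hrounds⟩
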